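/- Let $d>1$ be real, let $0<\theta<\tfrac12$, and let $a\in(-1,1)\setminus\{0\}$. Then the radial problem $$u''+\frac{d-1}{r}\,u'+u-|u|^{-2\theta}u=0\quad(r>0),\qquad u(0)=a,\quad u'(0)=0,$$ (where $|s|^{-2\theta}s$ is read as $0$ at $s=0$) has exactly one solution $u\in C^2([0,\infty))$. This solution has no zeros in $(0,\infty)$, and, with $c=1$ if $a>0$ and $c=-1$ if $a<0$, it oscillates around $c$: for every $R$ there are $x,y>R$ with $u(x)>c$ and $u(y)<c$. More precisely, there are sequences $0<r_0<t_0<r_1<t_1<\cdots$ tending to infinity such that $\{r>0: u(r)=c\}=\{r_k:k\ge0\}$ and $\{r>0:u'(r)=0\}=\{t_k:k\ge0\}$, every $t_k$ is a local extremum of $u$, and the values $u(t_k)$ lie alternately above and below $c$. Moreover $u(t_k)\to c$ as $k\to\infty$, and $u(r)\to c$ as $r\to\infty$. -/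

import Mathlib

open Set Filter Topology

/-- `u` is a classical (`C²` up to the origin) solution on `[0, ∞)` of
`u'' + ((d - 1) / r) u' + u - |u|^(-2θ) u = 0` for `r > 0`, with `u(0) = a`, `u'(0) = 0`.
Values of `u` at negative arguments play no role. At a zero of `u` the term `|u|^(-2θ) u` has the
value `0`, which is its continuous extension as `1 - 2θ > 0`. -/
structure IsRadialSolution (d θ a : ℝ) (u : ℝ → ℝ) : Prop where
  contDiffOn : ContDiffOn ℝ 2 u (Ici 0)
  equation : ∀ r : ℝ, 0 < r →
    deriv (deriv u) r + (d - 1) / r * deriv u r + u r - |u r| ^ (-2 * θ) * u r = 0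
  init_value : u 0 = a
  init_deriv : HasDerivWithinAt u 0 (Ici 0) 0

/-- `u` oscillates around `c` at infinity: beyond every point, `u` takes values above `c` and values
below `c`. -/
def OscillatesAround (u : ℝ → ℝ) (c : ℝ) : Prop :=
  ∀ R : ℝ, (∃ x, R < x ∧ c < u x) ∧ (∃ x, R < x ∧ u x < c)

/-- `ρ 0 < τ 0 < ρ 1 < τ 1 < ⋯` lists all the points of `(0, ∞)` where `u` takes the value `c`
(the `ρ k`) and all the critical points of `u` in `(0, ∞)` (the `τ k`); these points go to infinity,
every `τ k` is a local extremum, and the extremal values lie alternately above and below `c`. -/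
structure IsCrossingExtremaSequence (u : ℝ → ℝ) (c : ℝ) (ρ τ : ℕ → ℝ) : Prop where
  pos : 0 < ρ 0
  interlace : ∀ k, ρ k < τ k ∧ τ k < ρ (k + 1)
  tendsto_atTop : Tendsto ρ atTop atTop
  eq_iff : ∀ x : ℝ, 0 < x → (u x = c ↔ ∃ k, x = ρ k)
  deriv_eq_zero_iff : ∀ x : ℝ, 0 < x → (deriv u x = 0 ↔ ∃ k, x = τ k)
  extremum : ∀ k, IsLocalExtr u (τ k)
  alternate : ∀ k, (u (τ k) - c) * (u (τ (k + 1)) - c) < 0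

/-! The problem is singular at `r = 0`, and its force `x - |x|^(-2θ) x` fails to be Lipschitz only
at `x = 0`. By oddness it suffices to treat `0 < a < 1`. There the energy `v² / 2 + G(u)` is
nonincreasing, while the potential increases as `x` drops from `a` to `0`. Hence no solution falls
below `a`, and the force may be replaced below `a` by a linear one, giving a globally Lipschitz
`modifiedForce`. Existence is then a fixed point argument (`exists_radialFlow`) and uniqueness a
Gronwall estimate (`RadialFlow.eqOn`). `RadialFlow.init_le` transfers both to the original equation
and gives positivity.

The modified force is coercive about `1`: `g(x)(x - 1) ≥ 2θa (x - 1)²`. So the angle of `(u - 1, v)`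
keeps turning, which forces infinitely many crossings (`exists_eq_center`). A lower bound on the
energy makes the crossings transversal (`energy_pos`), and Rolle's theorem places exactly one
critical point between neighbours. The damping `(d - 1) / r` is not integrable at infinity, so the
energy decays to `0` and `u → 1` (`tendsto_center`). -/

/-- `u` with velocity `v` solves `u'' + ((d - 1) / r) u' + g(u) = 0` on `(0, ∞)`, with `u` and `v`
continuous up to the origin and `u 0 = a`, `v 0 = 0`. -/
structure RadialFlow (d : ℝ) (g : ℝ → ℝ) (a : ℝ) (u v : ℝ → ℝ) : Prop where
  continuousOn : ContinuousOn u (Ici 0)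
  continuousOn_vel : ContinuousOn v (Ici 0)
  hasDerivAt : ∀ r, 0 < r → HasDerivAt u (v r) r
  hasDerivAt_vel : ∀ r, 0 < r → HasDerivAt v (-((d - 1) / r * v r) - g (u r)) r
  init : u 0 = a
  init_vel : v 0 = 0

/-! ### The averaging operator that inverts the radial derivative. -/

/-- The weighted average `∫₀¹ σ^(d-1) h(σ s) dσ` of `h` over `[0, s]`. -/
noncomputable def radialMean (d : ℝ) (h : ℝ → ℝ) (s : ℝ) : ℝ :=
  ∫ σ in (0 : ℝ)..1, σ ^ (d - 1) * h (σ * s)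

section RadialMean

variable {d : ℝ} {h : ℝ → ℝ}

lemma continuous_rpow_sub_one (hd : 1 < d) : Continuous fun σ : ℝ => σ ^ (d - 1) :=
  Real.continuous_rpow_const (by linarith)

lemma continuous_radialMean (hd : 1 < d) (hh : Continuous h) : Continuous (radialMean d h) := by
  have h1 := continuous_rpow_sub_one hd
  unfold radialMean
  apply intervalIntegral.continuous_parametric_intervalIntegral_of_continuous'
  simp only [Function.uncurry_def]
  fun_prop

/-- Substituting `t = σ s` turns `s * radialMean d h s` into `s^(1-d) ∫₀^s t^(d-1) h(t) dt`. This is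
minus the velocity of a radial solution with forcing `h`. -/
lemma hasDerivAt_mul_radialMean_of_pos (hd : 1 < d) (hh : Continuous h) {s : ℝ} (hs : 0 < s) :
    HasDerivAt (fun s => s * radialMean d h s) (h s - (d - 1) * radialMean d h s) s := by
  have h1 := continuous_rpow_sub_one hd
  have hc : Continuous fun t : ℝ => t ^ (d - 1) * h t := by fun_prop
  have key : ∀ s : ℝ, 0 < s →
      radialMean d h s = s ^ (-d) * ∫ t in (0 : ℝ)..s, t ^ (d - 1) * h t := by
    intro s hs
    have e := intervalIntegral.integral_comp_mul_right
      (a := 0) (b := 1) (fun t : ℝ => t ^ (d - 1) * h t) hs.ne'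
    have e2 : ∫ σ in (0 : ℝ)..1, (σ * s) ^ (d - 1) * h (σ * s)
        = s ^ (d - 1) * radialMean d h s := by
      rw [radialMean, ← intervalIntegral.integral_const_mul]
      apply intervalIntegral.integral_congr
      intro σ hσ
      rw [uIcc_of_le zero_le_one] at hσ
      simp only
      rw [Real.mul_rpow hσ.1 hs.le]
      ring
    rw [e2] at e
    simp only [zero_mul, one_mul, smul_eq_mul] at e
    have e3 : s ^ (-d) = s⁻¹ * (s ^ (d - 1))⁻¹ := by
      rw [← Real.rpow_neg_one s, ← Real.rpow_neg hs.le, ← Real.rpow_add hs]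
      congr 1; ring
    have e4 : s ^ (d - 1) ≠ 0 := (Real.rpow_pos_of_pos hs _).ne'
    rw [e3]
    field_simp
    field_simp at e
    linarith
  have hI : HasDerivAt (fun s => ∫ t in (0 : ℝ)..s, t ^ (d - 1) * h t) (s ^ (d - 1) * h s) s :=
    intervalIntegral.integral_hasDerivAt_right (hc.intervalIntegrable _ _)
      hc.aestronglyMeasurable.stronglyMeasurableAtFilter hc.continuousAt
  have hp : HasDerivAt (fun s : ℝ => s ^ (1 - d)) ((1 - d) * s ^ (1 - d - 1)) s :=
    Real.hasDerivAt_rpow_const (Or.inl hs.ne')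
  have hprod := hp.mul hI
  refine (hprod.congr_of_eventuallyEq ?_).congr_deriv ?_
  · filter_upwards [lt_mem_nhds hs] with x hx
    rw [key x hx, ← mul_assoc]
    simp only [Pi.mul_apply]
    congr 1
    rw [show (1 - d) = 1 + -d by ring, Real.rpow_add hx, Real.rpow_one]
  · rw [key s hs]
    have e1 : s ^ (1 - d) * s ^ (d - 1) = 1 := by
      rw [← Real.rpow_add hs]; simp
    have e2 : (1 - d - 1) = -d := by ring
    rw [e2]
    linear_combination (h s) * e1

/-- Negative `s` follow by reflecting `h`. At `s = 0` the derivative is the limit of the nearby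
derivatives, which is why the formula avoids dividing by `s`. -/
lemma hasDerivAt_mul_radialMean (hd : 1 < d) (hh : Continuous h) (s : ℝ) :
    HasDerivAt (fun s => s * radialMean d h s) (h s - (d - 1) * radialMean d h s) s := by
  have hcm := continuous_radialMean hd hh
  have hne : ∀ s : ℝ, s ≠ 0 →
      HasDerivAt (fun s => s * radialMean d h s) (h s - (d - 1) * radialMean d h s) s := by
    intro s hs
    rcases lt_or_gt_of_ne hs with hs | hs
    · have e : ∀ x, radialMean d (fun t => h (-t)) (-x) = radialMean d h x := by
        intro x; simp [radialMean]
      have h1 := hasDerivAt_mul_radialMean_of_pos (h := fun t => h (-t)) hd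
        (hh.comp continuous_neg) (neg_pos.2 hs)
      have h2 := (h1.comp s (hasDerivAt_neg s)).neg
      refine (h2.congr_of_eventuallyEq (Eventually.of_forall fun x => ?_)).congr_deriv ?_
      · simp [e]
      · simp [e]
    · exact hasDerivAt_mul_radialMean_of_pos hd hh hs
  by_cases hs : s = 0
  · subst hs
    exact hasDerivAt_of_hasDerivAt_of_ne' (fun y hy => hne y hy)
      (continuous_id.mul hcm).continuousAt (by fun_prop) 0
  · exact hne s hs

lemma abs_mul_radialMean_le (hd : 1 < d) {D l : ℝ} (hl : 0 < l)
    (hD : ∀ t, 0 ≤ t → |h t| ≤ D * Real.exp (l * t)) {s : ℝ} (hs : 0 ≤ s) :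
    |s * radialMean d h s| ≤ D / l * Real.exp (l * s) := by
  have h1 := continuous_rpow_sub_one hd
  have hD0 : 0 ≤ D := by simpa using (abs_nonneg _).trans (hD 0 le_rfl)
  have e1 : ∫ σ in (0 : ℝ)..1, D * (s * Real.exp (l * (σ * s)))
      = D / l * Real.exp (l * s) - D / l := by
    have hder : ∀ σ : ℝ, HasDerivAt (fun σ => D / l * Real.exp (l * (σ * s)))
        (D * (s * Real.exp (l * (σ * s)))) σ := by
      intro σ
      have := ((((hasDerivAt_id σ).mul_const s).const_mul l).exp).const_mul (D / l)
      refine this.congr_deriv ?_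
      simp only [id]
      field_simp
    rw [intervalIntegral.integral_eq_sub_of_hasDerivAt (fun σ _ => hder σ)
      (Continuous.intervalIntegrable (by fun_prop) _ _)]
    simp
  have e2 : |s * radialMean d h s| ≤ ∫ σ in (0 : ℝ)..1, D * (s * Real.exp (l * (σ * s))) := by
    rw [radialMean, ← intervalIntegral.integral_const_mul, ← Real.norm_eq_abs]
    apply intervalIntegral.norm_integral_le_of_norm_le zero_le_one
    · refine Eventually.of_forall fun σ hσ => ?_
      have hσ0 : 0 ≤ σ := hσ.1.le
      have hp1 : σ ^ (d - 1) ≤ 1 := Real.rpow_le_one hσ0 hσ.2 (by linarith)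
      have hp0 : 0 ≤ σ ^ (d - 1) := Real.rpow_nonneg hσ0 _
      have hb := hD (σ * s) (mul_nonneg hσ0 hs)
      rw [Real.norm_eq_abs, abs_mul, abs_mul, abs_of_nonneg hs, abs_of_nonneg hp0]
      calc s * (σ ^ (d - 1) * |h (σ * s)|) ≤ s * (1 * |h (σ * s)|) := by gcongr
        _ ≤ s * (1 * (D * Real.exp (l * (σ * s)))) := by gcongr
        _ = _ := by ring
    · exact Continuous.intervalIntegrable (by fun_prop) _ _
  have : 0 ≤ D / l := by positivity
  linarith

/-- Each of the two integrations gains a factor `1 / l` against the weight `exp (l t)`; the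
resulting `1 / l²` makes the Picard map contract. -/
lemma abs_integral_mul_radialMean_le (hd : 1 < d) {D l : ℝ} (hl : 0 < l)
    (hD : ∀ t, 0 ≤ t → |h t| ≤ D * Real.exp (l * t)) {r : ℝ} (hr : 0 ≤ r) :
    |∫ s in (0 : ℝ)..r, s * radialMean d h s| ≤ D / l ^ 2 * Real.exp (l * r) := by
  have hD0 : 0 ≤ D := by simpa using (abs_nonneg _).trans (hD 0 le_rfl)
  have e1 : ∫ s in (0 : ℝ)..r, D / l * Real.exp (l * s)
      = D / l ^ 2 * Real.exp (l * r) - D / l ^ 2 := by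
    have hder : ∀ s : ℝ, HasDerivAt (fun s => D / l ^ 2 * Real.exp (l * s))
        (D / l * Real.exp (l * s)) s := by
      intro s
      have := (((hasDerivAt_id s).const_mul l).exp).const_mul (D / l ^ 2)
      refine this.congr_deriv ?_
      simp only [id]
      field_simp
    rw [intervalIntegral.integral_eq_sub_of_hasDerivAt (fun σ _ => hder σ)
      (Continuous.intervalIntegrable (by fun_prop) _ _)]
    simp
  have e2 : |∫ s in (0 : ℝ)..r, s * radialMean d h s|
      ≤ ∫ s in (0 : ℝ)..r, D / l * Real.exp (l * s) := by
    rw [← Real.norm_eq_abs]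
    apply intervalIntegral.norm_integral_le_of_norm_le hr
    · exact Eventually.of_forall fun s hs => abs_mul_radialMean_le hd hl hD hs.1.le
    · exact Continuous.intervalIntegrable (by fun_prop) _ _
  have : 0 ≤ D / l ^ 2 := by positivity
  linarith

lemma radialMean_sub (hd : 1 < d) {h₁ h₂ : ℝ → ℝ} (hh₁ : Continuous h₁) (hh₂ : Continuous h₂)
    (s : ℝ) : radialMean d (fun t => h₁ t - h₂ t) s = radialMean d h₁ s - radialMean d h₂ s := by
  have h1 := continuous_rpow_sub_one hd
  simp only [radialMean]
  rw [← intervalIntegral.integral_sub]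
  · simp only [mul_sub]
  · exact Continuous.intervalIntegrable (by fun_prop) _ _
  · exact Continuous.intervalIntegrable (by fun_prop) _ _

end RadialMean

/-! ### Existence for a globally Lipschitz force. -/

/-- The integral form `u(r) = a - ∫₀^r s ∫₀¹ σ^(d-1) g(u(σ s)) dσ ds` of the radial problem has a
continuous solution. -/
lemma exists_integral_solution {d : ℝ} (hd : 1 < d) {g : ℝ → ℝ} {K : NNReal}
    (hg : LipschitzWith K g) (a : ℝ) :
    ∃ h : ℝ → ℝ, Continuous h ∧
      ∀ r, 0 ≤ r → h r = g (a - ∫ s in (0 : ℝ)..r, s * radialMean d h s) := by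
  -- With this rate `K / l² ≤ 1 / 2`. The unknown is written `u = a + exp (l |t|) w` with `w`
  -- bounded, so one contraction covers the whole half-line; `|t|` only serves to let `w` live on
  -- `ℝ`. The function returned is `h = g ∘ u`.
  set l : ℝ := 2 * (K + 1) with hldef
  have hK0 : (0 : ℝ) ≤ K := K.2
  have hl : 0 < l := by positivity
  have hgc : Continuous g := hg.continuous
  set H : BoundedContinuousFunction ℝ ℝ → ℝ → ℝ :=
    fun w t => g (a + Real.exp (l * |t|) * w t) with hH
  have hHc : ∀ w, Continuous (H w) := fun w => by
    have := w.continuous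
    simp only [hH]; fun_prop
  set Ψ : BoundedContinuousFunction ℝ ℝ → ℝ → ℝ :=
    fun w r => -(Real.exp (-(l * |r|)) * ∫ s in (0 : ℝ)..|r|, s * radialMean d (H w) s) with hΨ
  have hΨc : ∀ w, Continuous (Ψ w) := fun w => by
    have h1 : Continuous fun s => s * radialMean d (H w) s :=
      continuous_id.mul (continuous_radialMean hd (hHc w))
    have h2 : Continuous fun r : ℝ => ∫ s in (0 : ℝ)..r, s * radialMean d (H w) s :=
      intervalIntegral.continuous_primitive (fun _ _ => h1.intervalIntegrable _ _) 0
    have h3 := h2.comp continuous_abs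
    simp only [hΨ]
    exact ((by fun_prop : Continuous fun r : ℝ => Real.exp (-(l * |r|))).mul h3).neg
  have hgabs : ∀ x y, |g x - g y| ≤ K * |x - y| := fun x y => by
    simpa [Real.dist_eq] using hg.dist_le_mul x y
  have hΨb : ∀ w, ∀ r, ‖Ψ w r‖ ≤ (|g a| + K * ‖w‖) / l ^ 2 := fun w r => by
    have hb := abs_integral_mul_radialMean_le (d := d) (h := H w) (D := |g a| + K * ‖w‖) hd hl
      (fun t ht => ?_) (abs_nonneg r)
    · simp only [hΨ, norm_neg, Real.norm_eq_abs, abs_mul, Real.abs_exp]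
      calc _ ≤ Real.exp (-(l * |r|)) * ((|g a| + K * ‖w‖) / l ^ 2 * Real.exp (l * |r|)) := by
            gcongr
        _ = _ := by
            rw [Real.exp_neg]
            field_simp
    · simp only [hH]
      have h1 := hgabs (a + Real.exp (l * |t|) * w t) a
      have h2 : |g (a + Real.exp (l * |t|) * w t)| ≤ |g a| +
          |g (a + Real.exp (l * |t|) * w t) - g a| := by
        have := abs_add_le (g a) (g (a + Real.exp (l * |t|) * w t) - g a)
        simpa using this
      have h3 : |w t| ≤ ‖w‖ := w.norm_coe_le_norm t
      have h4 : (1 : ℝ) ≤ Real.exp (l * t) := Real.one_le_exp (by positivity)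
      rw [add_sub_cancel_left, abs_mul, Real.abs_exp, abs_of_nonneg ht] at h1
      rw [abs_of_nonneg ht] at h2 ⊢
      calc _ ≤ |g a| + K * (Real.exp (l * t) * |w t|) := h2.trans (by gcongr)
        _ ≤ |g a| * Real.exp (l * t) + K * (Real.exp (l * t) * ‖w‖) := by
            gcongr
            exact le_mul_of_one_le_right (abs_nonneg _) h4
        _ = _ := by ring
  set Φ : BoundedContinuousFunction ℝ ℝ → BoundedContinuousFunction ℝ ℝ :=
    fun w => BoundedContinuousFunction.ofNormedAddCommGroup (Ψ w) (hΨc w) _ (hΨb w) with hΦ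
  have hcontr : ContractingWith (1 / 2) Φ := by
    refine ⟨by norm_num [← NNReal.coe_lt_coe], LipschitzWith.of_dist_le_mul fun w₁ w₂ => ?_⟩
    rw [BoundedContinuousFunction.dist_le (by positivity)]
    intro r
    have hb := abs_integral_mul_radialMean_le (d := d) (h := fun t => H w₁ t - H w₂ t)
      (D := K * dist w₁ w₂) hd hl (fun t ht => ?_) (abs_nonneg r)
    · have hi : ∀ w, IntervalIntegrable (fun s => s * radialMean d (H w) s)
          MeasureTheory.volume 0 |r| := fun w =>
        (continuous_id.mul (continuous_radialMean hd (hHc w))).intervalIntegrable _ _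
      have e : Φ w₁ r - Φ w₂ r = -(Real.exp (-(l * |r|)) *
          ∫ s in (0 : ℝ)..|r|, s * radialMean d (fun t => H w₁ t - H w₂ t) s) := by
        simp only [radialMean_sub hd (hHc w₁) (hHc w₂), mul_sub]
        rw [intervalIntegral.integral_sub (hi w₁) (hi w₂)]
        simp only [hΦ, hΨ, BoundedContinuousFunction.coe_ofNormedAddCommGroup]
        ring
      rw [Real.dist_eq, e, abs_neg, abs_mul, Real.abs_exp]
      have hKl : K / l ^ 2 ≤ 1 / 2 := by
        rw [div_le_div_iff₀ (by positivity) (by norm_num), hldef]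
        nlinarith
      calc _ ≤ Real.exp (-(l * |r|)) * (K * dist w₁ w₂ / l ^ 2 * Real.exp (l * |r|)) := by gcongr
        _ = K / l ^ 2 * dist w₁ w₂ := by
            rw [Real.exp_neg]
            field_simp
        _ ≤ 1 / 2 * dist w₁ w₂ := by gcongr
        _ = _ := by simp
    · have h1 := hgabs (a + Real.exp (l * |t|) * w₁ t) (a + Real.exp (l * |t|) * w₂ t)
      have h3 : |w₁ t - w₂ t| ≤ dist w₁ w₂ := by
        simpa [Real.dist_eq] using BoundedContinuousFunction.dist_coe_le_dist (f := w₁) (g := w₂) t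
      rw [add_sub_add_left_eq_sub, ← mul_sub, abs_mul, Real.abs_exp, abs_of_nonneg ht] at h1
      simp only [hH, abs_of_nonneg ht]
      calc _ ≤ K * (Real.exp (l * t) * |w₁ t - w₂ t|) := h1
        _ ≤ K * (Real.exp (l * t) * dist w₁ w₂) := by gcongr
        _ = _ := by ring
  set w := hcontr.fixedPoint Φ
  have hw : Φ w = w := hcontr.fixedPoint_isFixedPt
  refine ⟨H w, hHc w, fun r hr => ?_⟩
  have hwr : Ψ w r = w r := by
    conv_rhs => rw [← hw]
    simp [hΦ]
  change g (a + Real.exp (l * |r|) * w r) = _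
  rw [← hwr]
  simp only [hΨ, abs_of_nonneg hr]
  congr 1
  rw [Real.exp_neg]
  field_simp
  ring

lemma exists_radialFlow {d : ℝ} (hd : 1 < d) {g : ℝ → ℝ} {K : NNReal}
    (hg : LipschitzWith K g) (a : ℝ) :
    ∃ u v : ℝ → ℝ, ContDiff ℝ 2 u ∧ (∀ r, HasDerivAt u (v r) r) ∧ RadialFlow d g a u v := by
  obtain ⟨h, hc, hh⟩ := exists_integral_solution hd hg a
  have hm := continuous_radialMean hd hc
  have hVc : Continuous fun s => s * radialMean d h s := continuous_id.mul hm
  have hV := hasDerivAt_mul_radialMean hd hc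
  have hu : ∀ r, HasDerivAt (fun r => a - ∫ s in (0 : ℝ)..r, s * radialMean d h s)
      (-(r * radialMean d h r)) r := fun r =>
    (intervalIntegral.integral_hasDerivAt_right (hVc.intervalIntegrable _ _)
      hVc.aestronglyMeasurable.stronglyMeasurableAtFilter hVc.continuousAt).const_sub a
  refine ⟨_, _, ?_, hu, ?_⟩
  · rw [show (2 : WithTop ℕ∞) = 1 + 1 by norm_num, contDiff_succ_iff_deriv]
    refine ⟨fun r => (hu r).differentiableAt, by simp, ?_⟩
    have e : deriv (fun r => a - ∫ s in (0 : ℝ)..r, s * radialMean d h s)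
        = fun r => -(r * radialMean d h r) := funext fun r => (hu r).deriv
    rw [e, contDiff_one_iff_deriv]
    refine ⟨fun r => (hV r).neg.differentiableAt, ?_⟩
    have e' : deriv (fun r => -(r * radialMean d h r))
        = fun r => -(h r - (d - 1) * radialMean d h r) := funext fun r => (hV r).neg.deriv
    rw [e']
    fun_prop
  · refine ⟨fun r _ => (hu r).continuousAt.continuousWithinAt,
      hVc.neg.continuousOn, fun r _ => hu r, fun r hr => ?_, by simp, by simp⟩
    refine (hV r).neg.congr_deriv ?_
    rw [← hh r hr.le]
    field_simp
    ring

/-! ### Energy estimates and uniqueness. -/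

lemma antitoneOn_Ici_of_hasDerivAt_nonpos {f f' : ℝ → ℝ} {b : ℝ} (hc : ContinuousOn f (Ici b))
    (hf : ∀ x, b < x → HasDerivAt f (f' x) x) (hf' : ∀ x, b < x → f' x ≤ 0) :
    AntitoneOn f (Ici b) := by
  apply antitoneOn_of_hasDerivWithinAt_nonpos (f' := f') (convex_Ici b) hc
  · rw [interior_Ici]; exact fun x hx => (hf x hx).hasDerivWithinAt
  · rw [interior_Ici]; exact fun x hx => hf' x hx

namespace RadialFlow

variable {d a : ℝ} {g G u v : ℝ → ℝ}

lemma hasDerivAt_energy (hf : RadialFlow d g a u v) (hG : ∀ x, HasDerivAt G (g x) x) {r : ℝ}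
    (hr : 0 < r) :
    HasDerivAt (fun r => v r ^ 2 / 2 + G (u r)) (-((d - 1) / r * v r ^ 2)) r := by
  have h1 := ((hf.hasDerivAt_vel r hr).pow 2).div_const 2
  have h2 := (hG (u r)).comp r (hf.hasDerivAt r hr)
  refine (h1.add h2).congr_deriv ?_
  push_cast
  ring

lemma continuousOn_energy (hf : RadialFlow d g a u v) (hG : ∀ x, HasDerivAt G (g x) x) :
    ContinuousOn (fun r => v r ^ 2 / 2 + G (u r)) (Ici 0) := by
  have hGc : Continuous G := continuous_iff_continuousAt.2 fun x => (hG x).continuousAt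
  have h1 := hf.continuousOn
  have h2 := hf.continuousOn_vel
  have h3 : ContinuousOn (fun r => G (u r)) (Ici 0) := hGc.comp_continuousOn h1
  fun_prop

lemma antitoneOn_energy (hd : 1 < d) (hf : RadialFlow d g a u v)
    (hG : ∀ x, HasDerivAt G (g x) x) :
    AntitoneOn (fun r => v r ^ 2 / 2 + G (u r)) (Ici 0) :=
  antitoneOn_Ici_of_hasDerivAt_nonpos (hf.continuousOn_energy hG)
    (fun _ hr => hf.hasDerivAt_energy hG hr) fun r hr => by
      have : 0 ≤ (d - 1) / r := div_nonneg (by linarith) hr.le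
      have := mul_nonneg this (sq_nonneg (v r))
      linarith

lemma energy_le (hd : 1 < d) (hf : RadialFlow d g a u v) (hG : ∀ x, HasDerivAt G (g x) x) {r : ℝ}
    (hr : 0 ≤ r) : v r ^ 2 / 2 + G (u r) ≤ G a := by
  have := hf.antitoneOn_energy hd hG self_mem_Ici (mem_Ici.2 hr) hr
  simpa [hf.init, hf.init_vel] using this

/-- Although the energy decreases, `s^(2(d-1))` times it has derivative `2(d-1) s^(2d-3) G(u) ≥ 0`.
So it cannot reach `0` after starting near `G a > 0`. In particular `u` never meets the rest point
with zero velocity. -/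
lemma energy_pos (hd : 1 < d) (hf : RadialFlow d g a u v) (hG : ∀ x, HasDerivAt G (g x) x)
    (hG0 : ∀ x, 0 ≤ G x) (ha : 0 < G a) {r : ℝ} (hr : 0 < r) : 0 < v r ^ 2 / 2 + G (u r) := by
  have hder : ∀ s, 0 < s → HasDerivAt (fun s => s ^ (2 * (d - 1)) * (v s ^ 2 / 2 + G (u s)))
      (2 * (d - 1) * s ^ (2 * (d - 1) - 1) * (v s ^ 2 / 2 + G (u s)) +
        s ^ (2 * (d - 1)) * (-((d - 1) / s * v s ^ 2))) s := fun s hs =>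
    (Real.hasDerivAt_rpow_const (Or.inl hs.ne')).mul (hf.hasDerivAt_energy hG hs)
  have hmono : MonotoneOn (fun s => s ^ (2 * (d - 1)) * (v s ^ 2 / 2 + G (u s))) (Ioi 0) := by
    apply monotoneOn_of_hasDerivWithinAt_nonneg (convex_Ioi 0)
      (fun s hs => (hder s hs).continuousAt.continuousWithinAt)
    · rw [interior_Ioi]; exact fun s hs => (hder s hs).hasDerivWithinAt
    · rw [interior_Ioi]
      intro s hs
      have hs : 0 < s := hs
      have e : s ^ (2 * (d - 1)) = s ^ (2 * (d - 1) - 1) * s := by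
        rw [Real.rpow_sub_one hs.ne']; field_simp
      rw [e]
      have h1 : 0 < s ^ (2 * (d - 1) - 1) := Real.rpow_pos_of_pos hs _
      have e2 : 2 * (d - 1) * s ^ (2 * (d - 1) - 1) * (v s ^ 2 / 2 + G (u s)) +
          s ^ (2 * (d - 1) - 1) * s * (-((d - 1) / s * v s ^ 2))
          = s ^ (2 * (d - 1) - 1) * (2 * (d - 1) * G (u s)) := by
        field_simp; ring
      rw [e2]
      have := hG0 (u s)
      have : 0 < d - 1 := by linarith
      positivity
  have h0 : Tendsto (fun r => v r ^ 2 / 2 + G (u r)) (𝓝[>] 0) (𝓝 (G a)) := by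
    have := (hf.continuousOn_energy hG 0 self_mem_Ici).mono Ioi_subset_Ici_self
    simpa [ContinuousWithinAt, hf.init, hf.init_vel] using this
  obtain ⟨s, hs, hs0, hsr⟩ := ((h0.eventually (lt_mem_nhds ha)).and
    (Ioo_mem_nhdsGT hr)).exists
  have h1 := hmono (mem_Ioi.2 hs0) (mem_Ioi.2 hr) hsr.le
  have h2 : 0 < s ^ (2 * (d - 1)) * (v s ^ 2 / 2 + G (u s)) :=
    mul_pos (Real.rpow_pos_of_pos hs0 _) hs
  exact pos_of_mul_pos_right (h2.trans_le h1) (Real.rpow_nonneg hr.le _)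

/-- Gronwall for the squared distance in phase space. The singular damping enters only as `-2
(d-1)/r (v - v')²`, which has the good sign, so the estimate starts at `r = 0`. -/
lemma eqOn {u' v' : ℝ → ℝ} {K : NNReal} (hd : 1 < d) (hg : LipschitzWith K g)
    (hf : RadialFlow d g a u v) (hf' : RadialFlow d g a u' v') : EqOn u u' (Ici 0) := by
  set W : ℝ → ℝ := fun r => ((v r - v' r) ^ 2 + (u r - u' r) ^ 2) * Real.exp (-((K + 1) * r))
  have h1 := hf.continuousOn
  have h2 := hf.continuousOn_vel
  have h3 := hf'.continuousOn
  have h4 := hf'.continuousOn_vel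
  have hW : AntitoneOn W (Ici 0) := by
    refine antitoneOn_Ici_of_hasDerivAt_nonpos (by fun_prop) (fun r hr =>
      ((((hf.hasDerivAt_vel r hr).sub (hf'.hasDerivAt_vel r hr)).pow 2).add
        (((hf.hasDerivAt r hr).sub (hf'.hasDerivAt r hr)).pow 2)).mul
      (((hasDerivAt_id r).const_mul ((K : ℝ) + 1)).neg.exp)) fun r hr => ?_
    have hL : |g (u r) - g (u' r)| ≤ K * |u r - u' r| := by
      simpa [Real.dist_eq] using hg.dist_le_mul (u r) (u' r)
    have hq : 0 ≤ (d - 1) / r := div_nonneg (by linarith) hr.le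
    have hK0 : (0 : ℝ) ≤ K := K.2
    simp only [Pi.add_apply, Pi.pow_apply, Pi.sub_apply, Pi.neg_apply, id]
    push_cast
    set p := v r - v' r with hp
    set w := u r - u' r with hw
    set γ := g (u r) - g (u' r) with hγ
    have e : (2 : ℝ) * p ^ (2 - 1) * (-((d - 1) / r * v r) - g (u r) -
        (-((d - 1) / r * v' r) - g (u' r))) + 2 * w ^ (2 - 1) * p
        = -(2 * ((d - 1) / r * p ^ 2)) - 2 * (p * γ) + 2 * (p * w) := by
      rw [hp, hγ]; ring
    rw [e]
    have h5 : -(p * γ) ≤ K * (|p| * |w|) := by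
      calc -(p * γ) ≤ |p * γ| := neg_le_abs _
        _ = |p| * |γ| := abs_mul _ _
        _ ≤ |p| * (K * |w|) := by gcongr
        _ = _ := by ring
    have h6 : p * w ≤ |p| * |w| := by rw [← abs_mul]; exact le_abs_self _
    have h7 : 2 * (|p| * |w|) ≤ p ^ 2 + w ^ 2 := by
      rw [← sq_abs p, ← sq_abs w]; nlinarith [sq_nonneg (|p| - |w|)]
    have h8 := mul_nonneg hq (sq_nonneg p)
    have h9 : K * (2 * (|p| * |w|)) ≤ K * (p ^ 2 + w ^ 2) := by gcongr
    have h10 : -(2 * ((d - 1) / r * p ^ 2)) - 2 * (p * γ) + 2 * (p * w)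
        - (K + 1) * (p ^ 2 + w ^ 2) ≤ 0 := by nlinarith
    have h11 := mul_nonpos_of_nonpos_of_nonneg h10 (Real.exp_pos (-((K + 1) * r))).le
    linarith
  intro r hr
  have h5 := hW self_mem_Ici hr hr
  have h6 : W 0 = 0 := by simp [W, hf.init, hf.init_vel, hf'.init, hf'.init_vel]
  rw [h6] at h5
  have h7 : (v r - v' r) ^ 2 + (u r - u' r) ^ 2 ≤ 0 :=
    nonpos_of_mul_nonpos_left h5 (Real.exp_pos _)
  have h8 : (u r - u' r) ^ 2 = 0 := le_antisymm (by nlinarith [sq_nonneg (v r - v' r)])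
    (sq_nonneg _)
  exact sub_eq_zero.1 (pow_eq_zero_iff two_ne_zero |>.1 h8)

/-! ### Oscillation about the center and decay to it. -/

/-- Prüfer angle: while `u ≠ c`, `arctan (v / (u - c))` is smooth. Once `(d-1)/r ≤ m` it decreases
at rate at least `m / 2`. Over a length `2π / m` it would drop by `π`, the full width of its open
range. -/
lemma exists_eq_center {c κ : ℝ} (hd : 1 < d) (hf : RadialFlow d g a u v) (hκ : 0 < κ)
    (hg : ∀ x, κ * (x - c) ^ 2 ≤ g x * (x - c)) (R : ℝ) : ∃ r, R < r ∧ u r = c := by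
  by_contra! hne
  set m := min κ 1 with hm
  have hm0 : 0 < m := lt_min hκ one_pos
  have hmκ : m ≤ κ := min_le_left _ _
  have hm1 : m ≤ 1 := min_le_right _ _
  set R₁ := max (R + 1) ((d - 1) / m) with hR₁
  have hR₁0 : 0 < R₁ := (div_pos (by linarith) hm0).trans_le (le_max_right _ _)
  have hw : ∀ r, R₁ ≤ r → u r - c ≠ 0 := fun r hr =>
    sub_ne_zero.2 (hne r (by have := le_max_left (R + 1) ((d - 1) / m); linarith))
  have hder : ∀ r, R₁ ≤ r → HasDerivAt
      (fun r => m / 2 * r + Real.arctan (v r / (u r - c))) _ r := fun r hr =>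
    ((hasDerivAt_id r).const_mul (m / 2)).add
      (((hf.hasDerivAt_vel r (hR₁0.trans_le hr)).div
        ((hf.hasDerivAt r (hR₁0.trans_le hr)).sub_const c) (hw r hr)).arctan)
  have hanti : AntitoneOn (fun r => m / 2 * r + Real.arctan (v r / (u r - c))) (Ici R₁) := by
    refine antitoneOn_Ici_of_hasDerivAt_nonpos
      (fun r hr => (hder r hr).continuousAt.continuousWithinAt)
      (fun r hr => hder r hr.le) fun r hr => ?_
    have hr0 : 0 < r := hR₁0.trans hr
    have hw' := hw r hr.le
    have hgr := hg (u r)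
    have hq0 : 0 ≤ (d - 1) / r := div_nonneg (by linarith) hr0.le
    have hq : (d - 1) / r ≤ m := by
      rw [div_le_iff₀ hr0]
      have : (d - 1) / m ≤ r := (le_max_right _ _).trans hr.le
      rw [div_le_iff₀ hm0] at this
      linarith
    simp only [Pi.div_apply]
    set p := v r
    set w := u r - c
    set γ := g (u r)
    set q := (d - 1) / r
    have hs : 0 < w ^ 2 + p ^ 2 := by positivity
    have e : m / 2 * 1 + 1 / (1 + (p / w) ^ 2) * (((-(q * p) - γ) * w - p * p) / w ^ 2)
        = (m / 2 * (w ^ 2 + p ^ 2) - q * (p * w) - γ * w - p ^ 2) / (w ^ 2 + p ^ 2) := by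
      field_simp
      ring
    rw [e]
    apply div_nonpos_of_nonpos_of_nonneg _ hs.le
    have h1 : -(2 * (p * w)) ≤ w ^ 2 + p ^ 2 := by nlinarith [sq_nonneg (p + w)]
    have h2 : q * (-(2 * (p * w))) ≤ m * (w ^ 2 + p ^ 2) :=
      (mul_le_mul_of_nonneg_left h1 hq0).trans (by gcongr)
    have h3 : m * w ^ 2 ≤ κ * w ^ 2 := by gcongr
    have h4 : m * p ^ 2 ≤ 1 * p ^ 2 := by gcongr
    linarith
  have hpos : 0 ≤ 2 * Real.pi / m := by positivity
  have h1 := hanti self_mem_Ici (mem_Ici.2 (by linarith : R₁ ≤ R₁ + 2 * Real.pi / m))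
    (by linarith)
  have h2 := Real.arctan_lt_pi_div_two (v R₁ / (u R₁ - c))
  have h3 := Real.neg_pi_div_two_lt_arctan
    (v (R₁ + 2 * Real.pi / m) / (u (R₁ + 2 * Real.pi / m) - c))
  have h4 : m / 2 * (R₁ + 2 * Real.pi / m) = m / 2 * R₁ + Real.pi := by field_simp
  simp only at h1
  rw [h4] at h1
  linarith

/-- The energy controls `(u - c)²` and is nonincreasing, so it need only become small somewhere. The
dissipation sees only `v²`; adding `β/r (u - c) v` trades half of it for `g(u)(u - c)`. If the
energy stayed above `e`, the sum would lose at least `β m e / r` up to `O(r⁻²)`, hence diverge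
logarithmically, yet it is bounded below. -/
lemma tendsto_center {c κ η : ℝ} (hd : 1 < d) (hf : RadialFlow d g a u v) (hκ : 0 < κ)
    (hη : 0 < η) (hG : ∀ x, HasDerivAt G (g x) x) (hGlow : ∀ x, κ * (x - c) ^ 2 ≤ G x)
    (hgG : ∀ x, η * G x ≤ g x * (x - c)) : Tendsto u atTop (𝓝 c) := by
  have hG0 : ∀ x, 0 ≤ G x := fun x => (by positivity : 0 ≤ κ * (x - c) ^ 2).trans (hGlow x)
  have small : ∀ e, 0 < e → ∃ r, 0 < r ∧ v r ^ 2 / 2 + G (u r) < e := by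
    intro e he
    by_contra! hE
    set β := (d - 1) / 2 with hβ
    have hβ0 : 0 < β := by rw [hβ]; linarith
    set m := min 1 η with hm
    have hm0 : 0 < m := lt_min one_pos hη
    set B := G a + G a / κ with hB
    have hvw : ∀ r, 0 ≤ r → |(u r - c) * v r| ≤ B := by
      intro r hr
      have h1 := hf.energy_le hd hG hr
      have h2 := hGlow (u r)
      have h3 := hG0 (u r)
      have h5 : (u r - c) ^ 2 ≤ G a / κ := by
        rw [le_div_iff₀ hκ]; nlinarith [sq_nonneg (v r)]
      have h6 : v r ^ 2 ≤ 2 * G a := by linarith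
      have h7 : 0 ≤ G a / κ := div_nonneg (hG0 a) hκ.le
      rw [abs_le, hB]
      constructor
      · nlinarith [sq_nonneg (u r - c + v r)]
      · nlinarith [sq_nonneg (u r - c - v r)]
    -- The logarithm collects the guaranteed loss and `β d B / r` absorbs the `O(r⁻²)` error, so the
    -- total is nonincreasing.
    have hder : ∀ r, 0 < r → HasDerivAt (fun r => v r ^ 2 / 2 + G (u r) +
        β / r * ((u r - c) * v r) + β * m * e * Real.log r + β * d * B / r)
        (-(β / r) * (v r ^ 2 + g (u r) * (u r - c)) - β * d / r ^ 2 * ((u r - c) * v r)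
          + β * m * e / r - β * d * B / r ^ 2) r := by
      intro r hr
      have hinv : ∀ C : ℝ, HasDerivAt (fun r => C / r) (-(C / r ^ 2)) r := fun C => by
        have := (hasDerivAt_inv hr.ne').const_mul C
        simpa [div_eq_mul_inv] using this
      have h1 := (hf.hasDerivAt_energy hG hr).add ((hinv β).mul
        (((hf.hasDerivAt r hr).sub_const c).mul (hf.hasDerivAt_vel r hr)))
      have h2 := (h1.add ((Real.hasDerivAt_log hr.ne').const_mul (β * m * e))).add
        (hinv (β * d * B))
      refine h2.congr_deriv ?_
      have : d = 2 * β + 1 := by rw [hβ]; ring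
      simp only [this, Pi.mul_apply]
      field_simp
      ring
    have hanti : AntitoneOn (fun r => v r ^ 2 / 2 + G (u r) +
        β / r * ((u r - c) * v r) + β * m * e * Real.log r + β * d * B / r) (Ici 1) := by
      refine antitoneOn_Ici_of_hasDerivAt_nonpos
        (fun r hr => (hder r (zero_lt_one.trans_le hr)).continuousAt.continuousWithinAt)
        (fun r hr => hder r (zero_lt_one.trans hr)) fun r hr => ?_
      have hr0 : 0 < r := zero_lt_one.trans hr
      have h1 : m * e ≤ v r ^ 2 + g (u r) * (u r - c) := by
        have h2 := hE r hr0
        have h3 := hgG (u r)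
        have h4 : m * (v r ^ 2 / 2) ≤ 1 * (v r ^ 2 / 2) := by
          gcongr; exact min_le_left _ _
        have h5 : m * G (u r) ≤ η * G (u r) :=
          mul_le_mul_of_nonneg_right (min_le_right _ _) (hG0 _)
        have h6 : m * e ≤ m * (v r ^ 2 / 2 + G (u r)) := by gcongr
        nlinarith [sq_nonneg (v r)]
      have h2 := (abs_le.1 (hvw r hr0.le)).1
      have h3 : β / r * (m * e) ≤ β / r * (v r ^ 2 + g (u r) * (u r - c)) := by gcongr
      have h4 : β * d / r ^ 2 * (-B) ≤ β * d / r ^ 2 * ((u r - c) * v r) := by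
        have : 0 < d := by linarith
        gcongr
      have e1 : β * m * e / r = β / r * (m * e) := by ring
      have e2 : β * d * B / r ^ 2 = -(β * d / r ^ 2 * (-B)) := by ring
      rw [e1, e2]
      linarith
    have hlog : Tendsto (fun r => β * m * e * Real.log r) atTop atTop :=
      Real.tendsto_log_atTop.const_mul_atTop (by positivity)
    set Y := v 1 ^ 2 / 2 + G (u 1) +
        β / 1 * ((u 1 - c) * v 1) + β * m * e * Real.log 1 + β * d * B / 1 with hY
    obtain ⟨r, hrY, hr1⟩ := ((hlog.eventually_gt_atTop (Y + β * B)).and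
      (eventually_ge_atTop 1)).exists
    have h1 := hanti self_mem_Ici (mem_Ici.2 hr1) hr1
    simp only [← hY] at h1
    have hr0 : 0 < r := zero_lt_one.trans_le hr1
    have hB0 : 0 ≤ B := (abs_nonneg _).trans (hvw r hr0.le)
    have h2 : |β / r * ((u r - c) * v r)| ≤ β * B := by
      rw [abs_mul, abs_of_pos (div_pos hβ0 hr0)]
      exact mul_le_mul (div_le_self hβ0.le hr1) (hvw r hr0.le) (abs_nonneg _) hβ0.le
    have h3 := (abs_le.1 h2).1
    have h4 : 0 ≤ β * d * B / r := by
      have : 0 < d := by linarith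
      positivity
    have h5 := hG0 (u r)
    have h6 := sq_nonneg (v r)
    linarith
  rw [Metric.tendsto_atTop]
  intro ε hε
  obtain ⟨R, hR0, hR⟩ := small (κ * ε ^ 2) (by positivity)
  refine ⟨R, fun r hr => ?_⟩
  have h1 := hf.antitoneOn_energy hd hG (mem_Ici.2 hR0.le) (mem_Ici.2 (hR0.le.trans hr)) hr
  simp only at h1
  have h2 := hGlow (u r)
  have h3 : κ * (u r - c) ^ 2 < κ * ε ^ 2 := by nlinarith [sq_nonneg (v r)]
  have h4 := lt_of_mul_lt_mul_left h3 hκ.le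
  rw [Real.dist_eq]
  exact abs_lt_of_sq_lt_sq h4 hε.le

end RadialFlow

/-! ### Enumerating crossings and critical points. -/

lemma exists_le_lt_succ_of_tendsto_atTop {ρ : ℕ → ℝ} (hρ : Tendsto ρ atTop atTop) {x : ℝ}
    (hx : ρ 0 ≤ x) : ∃ k, ρ k ≤ x ∧ x < ρ (k + 1) := by
  classical
  have hex : ∃ n, x < ρ n := (hρ.eventually_gt_atTop x).exists
  obtain ⟨k, hk⟩ := Nat.exists_eq_succ_of_ne_zero (n := Nat.find hex) fun h0 => by
    have := Nat.find_spec hex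
    rw [h0] at this
    linarith
  refine ⟨k, not_lt.1 (Nat.find_min hex (by omega)), ?_⟩
  have := Nat.find_spec hex
  rwa [hk] at this

/-- An unbounded subset of `(0, ∞)` without accumulation points in `[0, ∞)` is the range of a
strictly increasing sequence tending to infinity. -/
lemma exists_strictMono_enumeration {Z : Set ℝ} (hpos : ∀ z ∈ Z, 0 < z)
    (hunb : ∀ R, ∃ z, R < z ∧ z ∈ Z) (hiso : ∀ x, 0 ≤ x → ∀ᶠ y in 𝓝[≠] x, y ∉ Z) :
    ∃ ρ : ℕ → ℝ, StrictMono ρ ∧ Tendsto ρ atTop atTop ∧ ∀ x, x ∈ Z ↔ ∃ k, x = ρ k := by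
  -- A next element exists: the infimum of `Z ∩ (x, ∞)` is attained, since otherwise it would be an
  -- accumulation point of `Z`.
  have next : ∀ x, 0 ≤ x → ∃ z, z ∈ Z ∧ x < z ∧ ∀ y ∈ Z, x < y → z ≤ y := by
    intro x hx
    set S := Z ∩ Ioi x
    have hne : S.Nonempty := by
      obtain ⟨z, hz, hzZ⟩ := hunb x
      exact ⟨z, hzZ, hz⟩
    have hbdd : BddBelow S := ⟨x, fun y hy => hy.2.le⟩
    have hxi : x ≤ sInf S := le_csInf hne fun y hy => hy.2.le
    have hmem : sInf S ∈ S := by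
      by_contra hn
      have h1 := (hiso _ (hx.trans hxi)).filter_mono (nhdsWithin_mono _ fun y hy => ne_of_gt hy :
        𝓝[>] (sInf S) ≤ 𝓝[≠] (sInf S))
      obtain ⟨b, hb, hsub⟩ := mem_nhdsGT_iff_exists_Ioo_subset.1 h1
      obtain ⟨s, hsS, hsb⟩ := (csInf_lt_iff hbdd hne).1 hb
      have h2 : sInf S < s := lt_of_le_of_ne (csInf_le hbdd hsS) fun h => hn (h ▸ hsS)
      exact hsub ⟨h2, hsb⟩ hsS.1
    exact ⟨sInf S, hmem.1, hmem.2, fun y hy hxy => csInf_le hbdd ⟨hy, hxy⟩⟩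
  choose! N hNZ hNlt hNle using next
  set ρ : ℕ → ℝ := fun n => N^[n + 1] 0
  have hsucc : ∀ n, ρ (n + 1) = N (ρ n) := fun n => Function.iterate_succ_apply' N (n + 1) 0
  have hmem : ∀ n, ρ n ∈ Z := by
    intro n
    induction n with
    | zero => exact hNZ 0 le_rfl
    | succ k ih => rw [hsucc]; exact hNZ _ (hpos _ ih).le
  have hmono : StrictMono ρ := strictMono_nat_of_lt_succ fun n => by
    rw [hsucc]; exact hNlt _ (hpos _ (hmem n)).le
  have htend : Tendsto ρ atTop atTop := by
    rcases tendsto_atTop_of_monotone hmono.monotone with h | ⟨l, hl⟩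
    · exact h
    · exfalso
      have hlt : ∀ n, ρ n < l := fun n =>
        (hmono n.lt_succ_self).trans_le (hmono.monotone.ge_of_tendsto hl _)
      have h1 : Tendsto ρ atTop (𝓝[≠] l) :=
        tendsto_nhdsWithin_iff.2 ⟨hl, Eventually.of_forall fun n => (hlt n).ne⟩
      obtain ⟨n, hn⟩ := (h1.eventually (hiso l ((hpos _ (hmem 0)).trans (hlt 0)).le)).exists
      exact hn (hmem n)
  refine ⟨ρ, hmono, htend, fun x => ⟨fun hx => ?_, ?_⟩⟩
  · obtain ⟨k, hk1, hk2⟩ := exists_le_lt_succ_of_tendsto_atTop htend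
      (hNle 0 le_rfl x hx (hpos x hx) : ρ 0 ≤ x)
    refine ⟨k, le_antisymm (not_lt.1 fun hlt => ?_) hk1⟩
    have := hNle _ (hpos _ (hmem k)).le x hx hlt
    rw [← hsucc] at this
    linarith
  · rintro ⟨k, rfl⟩
    exact hmem k

lemma mul_pos_of_forall_ne {u : ℝ → ℝ} {c x y : ℝ} (hu : ContinuousOn u (uIcc x y))
    (hne : ∀ z ∈ uIcc x y, u z ≠ c) : 0 < (u x - c) * (u y - c) := by
  by_contra! h
  have hc : c ∈ uIcc (u x) (u y) := by
    rw [mem_uIcc]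
    rcases le_total (u x) (u y) with hxy | hxy
    · left; constructor <;> nlinarith
    · right; constructor <;> nlinarith
  obtain ⟨z, hz, hzc⟩ := intermediate_value_uIcc hu hc
  exact hne z hz hzc

namespace IsCrossingExtremaSequence

variable {u : ℝ → ℝ} {c : ℝ} {ρ τ : ℕ → ℝ}

lemma tendsto_extrema (h : IsCrossingExtremaSequence u c ρ τ) : Tendsto τ atTop atTop :=
  tendsto_atTop_mono (fun k => (h.interlace k).1.le) h.tendsto_atTop

lemma oscillatesAround (h : IsCrossingExtremaSequence u c ρ τ) : OscillatesAround u c := by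
  intro R
  obtain ⟨k, hk⟩ := (h.tendsto_extrema.eventually_gt_atTop R).exists
  have hk' : R < τ (k + 1) := hk.trans ((h.interlace k).2.trans (h.interlace (k + 1)).1)
  rcases mul_neg_iff.1 (h.alternate k) with ⟨h1, h2⟩ | ⟨h1, h2⟩
  · exact ⟨⟨_, hk, by linarith⟩, ⟨_, hk', by linarith⟩⟩
  · exact ⟨⟨_, hk', by linarith⟩, ⟨_, hk, by linarith⟩⟩

lemma neg (h : IsCrossingExtremaSequence u c ρ τ) : IsCrossingExtremaSequence (-u) (-c) ρ τ where
  pos := h.pos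
  interlace := h.interlace
  tendsto_atTop := h.tendsto_atTop
  eq_iff x hx := by simpa using h.eq_iff x hx
  deriv_eq_zero_iff x hx := by simpa using h.deriv_eq_zero_iff x hx
  extremum k := by
    rcases h.extremum k with h1 | h1
    · exact Or.inr h1.neg
    · exact Or.inl h1.neg
  alternate k := by
    have := h.alternate k
    simp only [Pi.neg_apply]
    linarith

end IsCrossingExtremaSequence

namespace RadialFlow

variable {d a : ℝ} {g G u v : ℝ → ℝ}

/-- Rolle's theorem for `r^(d-1) v`, whose derivative is `-r^(d-1) g(u)`. The endpoint `s = 0` is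
allowed. -/
lemma exists_eq_zero_nonlinearity (hd : 1 < d) (hf : RadialFlow d g a u v) {s t : ℝ} (hs : 0 ≤ s)
    (hst : s < t) (hvs : v s = 0) (hvt : v t = 0) : ∃ r ∈ Ioo s t, g (u r) = 0 := by
  have hc : ContinuousOn (fun r => r ^ (d - 1) * v r) (Icc s t) := by
    refine (Real.continuous_rpow_const (by linarith)).continuousOn.mul
      (hf.continuousOn_vel.mono fun r hr => hs.trans hr.1)
  obtain ⟨r, hr, h0⟩ := exists_hasDerivAt_eq_zero hst hc (by simp [hvs, hvt])
    fun r hr => (Real.hasDerivAt_rpow_const (p := d - 1) (Or.inl (hs.trans_lt hr.1).ne')).mul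
      (hf.hasDerivAt_vel r (hs.trans_lt hr.1))
  refine ⟨r, hr, ?_⟩
  have hr0 : 0 < r := hs.trans_lt hr.1
  have hp : r ^ (d - 1) ≠ 0 := (Real.rpow_pos_of_pos hr0 _).ne'
  rw [Real.rpow_sub_one hr0.ne' (d - 1)] at h0
  have h1 : r ^ (d - 1) * -g (u r) = 0 := by
    rw [← h0]; field_simp; ring
  simpa [hp] using h1

lemma isLocalExtr (hf : RadialFlow d g a u v) {r : ℝ} (hr : 0 < r) (hv : v r = 0)
    (hg : g (u r) ≠ 0) : IsLocalExtr u r := by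
  have h1 : deriv u r = 0 := by rw [(hf.hasDerivAt r hr).deriv, hv]
  have h2 : deriv u =ᶠ[𝓝 r] v := by
    filter_upwards [lt_mem_nhds hr] with x hx using (hf.hasDerivAt x hx).deriv
  have h3 : deriv (deriv u) r = -g (u r) := by
    rw [h2.deriv_eq, (hf.hasDerivAt_vel r hr).deriv, hv]; ring
  have hc := (hf.hasDerivAt r hr).continuousAt
  rcases lt_or_gt_of_ne hg with hlt | hgt
  · exact Or.inl (isLocalMin_of_deriv_deriv_pos (by rw [h3]; linarith) h1 hc)
  · exact Or.inr (isLocalMax_of_deriv_deriv_neg (by rw [h3]; linarith) h1 hc)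

/-- Transversality isolates the crossings. Between two critical points `g(u)` vanishes, so `u = c`
there; hence each gap between consecutive crossings holds exactly one critical point. -/
lemma exists_isCrossingExtremaSequence {c κ κ' : ℝ} (hd : 1 < d) (hf : RadialFlow d g a u v)
    (hκ : 0 < κ) (hg : ∀ x, κ * (x - c) ^ 2 ≤ g x * (x - c)) (hG : ∀ x, HasDerivAt G (g x) x)
    (hκ' : 0 < κ') (hGlow : ∀ x, κ' * (x - c) ^ 2 ≤ G x) (hGc : G c = 0) (hac : a ≠ c) :
    ∃ ρ τ, IsCrossingExtremaSequence u c ρ τ := by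
  have hG0 : ∀ x, 0 ≤ G x := fun x => (by positivity : 0 ≤ κ' * (x - c) ^ 2).trans (hGlow x)
  have hac' : a - c ≠ 0 := sub_ne_zero.2 hac
  have hGa : 0 < G a := (by positivity : 0 < κ' * (a - c) ^ 2).trans_le (hGlow a)
  have hv : ∀ r, 0 < r → u r = c → v r ≠ 0 := by
    intro r hr huc hvr
    have := hf.energy_pos hd hG hG0 hGa hr
    simp [huc, hvr, hGc] at this
  have hg0 : ∀ x, g x = 0 → x = c := by
    intro x hx
    have h1 := hg x
    rw [hx, zero_mul] at h1
    have h2 : (x - c) ^ 2 = 0 := le_antisymm (by nlinarith) (sq_nonneg _)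
    exact sub_eq_zero.1 (pow_eq_zero_iff two_ne_zero |>.1 h2)
  have hcross : ∀ s t, 0 ≤ s → s < t → v s = 0 → v t = 0 → ∃ r ∈ Ioo s t, u r = c := by
    intro s t hs hst h1 h2
    obtain ⟨r, hr, h⟩ := hf.exists_eq_zero_nonlinearity hd hs hst h1 h2
    exact ⟨r, hr, hg0 _ h⟩
  obtain ⟨ρ, hmono, htend, hρ⟩ := exists_strictMono_enumeration
    (Z := {x | 0 < x ∧ u x = c}) (fun z hz => hz.1) (fun R => by
      obtain ⟨r, hr, hrc⟩ := hf.exists_eq_center hd hκ hg (max R 0)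
      exact ⟨r, (le_max_left _ _).trans_lt hr, (le_max_right _ _).trans_lt hr, hrc⟩)
    (fun x hx => by
      rcases hx.eq_or_lt with rfl | hx
      · have h1 : ∀ᶠ y in 𝓝[≥] (0 : ℝ), u y ≠ c :=
          (hf.continuousOn 0 self_mem_Ici).eventually_ne (by rwa [hf.init])
        rw [eventually_nhdsWithin_iff] at h1
        filter_upwards [h1.filter_mono nhdsWithin_le_nhds] with y hy hyZ
        exact hy hyZ.1.le hyZ.2
      · by_cases hux : u x = c
        · filter_upwards [(hf.hasDerivAt x hx).eventually_ne (c := c) (hv x hx hux)] with y hy hyZ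
          exact hy hyZ.2
        · filter_upwards [((hf.hasDerivAt x hx).continuousAt.eventually_ne hux).filter_mono
            nhdsWithin_le_nhds] with y hy hyZ
          exact hy hyZ.2)
  have hρZ : ∀ k, 0 < ρ k ∧ u (ρ k) = c := fun k => (hρ _).2 ⟨k, rfl⟩
  have hgap : ∀ k x, ρ k < x → x < ρ (k + 1) → u x ≠ c := by
    intro k x h1 h2 hx
    obtain ⟨j, rfl⟩ := (hρ x).1 ⟨(hρZ k).1.trans h1, hx⟩
    have h3 := hmono.lt_iff_lt.1 h1
    have h4 := hmono.lt_iff_lt.1 h2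
    omega
  have hτex : ∀ k, ∃ t ∈ Ioo (ρ k) (ρ (k + 1)), v t = 0 := fun k =>
    exists_hasDerivAt_eq_zero (hmono k.lt_succ_self)
      (hf.continuousOn.mono fun r hr => (hρZ k).1.le.trans hr.1)
      (by rw [(hρZ k).2, (hρZ (k + 1)).2])
      fun r hr => hf.hasDerivAt r ((hρZ k).1.trans hr.1)
  choose τ hτmem hτv using hτex
  have hτ0 : ∀ k, 0 < τ k := fun k => (hρZ k).1.trans (hτmem k).1
  have hτc : ∀ k, u (τ k) ≠ c := fun k => hgap k _ (hτmem k).1 (hτmem k).2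
  have hsign : ∀ k x, ρ k < x → x < ρ (k + 1) → 0 < (u (τ k) - c) * (u x - c) := by
    intro k x h1 h2
    have hsub : ∀ z ∈ uIcc (τ k) x, ρ k < z ∧ z < ρ (k + 1) := fun z hz =>
      ⟨(lt_min (hτmem k).1 h1).trans_le hz.1, hz.2.trans_lt (max_lt (hτmem k).2 h2)⟩
    exact mul_pos_of_forall_ne
      (hf.continuousOn.mono fun z hz => ((hρZ k).1.trans (hsub z hz).1).le)
      fun z hz => hgap k z (hsub z hz).1 (hsub z hz).2
  refine ⟨ρ, τ, (hρZ 0).1, hτmem, htend, fun x hx => ?_, fun x hx => ?_, fun k => ?_, fun k => ?_⟩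
  · rw [← hρ]
    exact ⟨fun h => ⟨hx, h⟩, fun h => h.2⟩
  · rw [(hf.hasDerivAt x hx).deriv]
    refine ⟨fun hvx => ?_, ?_⟩
    · rcases lt_or_ge x (ρ 0) with hx0 | hx0
      -- The origin is itself critical, so a critical point before `ρ 0` would force an earlier
      -- crossing.
      · obtain ⟨r, hr, hrc⟩ := hcross 0 x le_rfl hx hf.init_vel hvx
        obtain ⟨j, rfl⟩ := (hρ r).1 ⟨hr.1, hrc⟩
        have := hmono.monotone (Nat.zero_le j)
        linarith [hr.2]
      · obtain ⟨k, hk1, hk2⟩ := exists_le_lt_succ_of_tendsto_atTop htend hx0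
        have hk1 : ρ k < x := hk1.lt_of_ne fun h => hv x hx (h ▸ (hρZ k).2) hvx
        refine ⟨k, ?_⟩
        rcases lt_trichotomy x (τ k) with h | h | h
        · obtain ⟨r, hr, hrc⟩ := hcross x (τ k) hx.le h hvx (hτv k)
          exact absurd hrc (hgap k r (hk1.trans hr.1) (hr.2.trans (hτmem k).2))
        · exact h
        · obtain ⟨r, hr, hrc⟩ := hcross (τ k) x (hτ0 k).le h (hτv k) hvx
          exact absurd hrc (hgap k r ((hτmem k).1.trans hr.1) (hr.2.trans hk2))
    · rintro ⟨k, rfl⟩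
      exact hτv k
  · exact hf.isLocalExtr (hτ0 k) (hτv k) fun h => hτc k (hg0 _ h)
  -- If `u - c` kept its sign across `ρ (k + 1)`, that crossing would be a local extremum with zero
  -- velocity, against transversality.
  · by_contra! hge
    have hpos : 0 < (u (τ k) - c) * (u (τ (k + 1)) - c) :=
      hge.lt_of_ne (mul_ne_zero (sub_ne_zero.2 (hτc k)) (sub_ne_zero.2 (hτc (k + 1)))).symm
    have hnear : ∀ᶠ x in 𝓝 (ρ (k + 1)), 0 ≤ (u (τ k) - c) * (u x - c) := by
      filter_upwards [Ioo_mem_nhds (hmono k.lt_succ_self) (hmono (k + 1).lt_succ_self)] with x hx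
      rcases lt_trichotomy x (ρ (k + 1)) with h | h | h
      · exact (hsign k x hx.1 h).le
      · simp [h, (hρZ (k + 1)).2]
      · have h1 := hsign (k + 1) x h hx.2
        by_contra! h2
        nlinarith [mul_pos hpos h1, mul_neg_of_pos_of_neg
          (even_two.pow_pos (sub_ne_zero.2 (hτc (k + 1)))) h2]
    have hder := hf.hasDerivAt _ (hρZ (k + 1)).1
    refine hv _ (hρZ (k + 1)).1 (hρZ (k + 1)).2 ?_
    rcases lt_or_gt_of_ne (sub_ne_zero.2 (hτc k)) with hs | hs
    · refine IsLocalMax.hasDerivAt_eq_zero ?_ hder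
      filter_upwards [hnear] with x hx
      rw [(hρZ (k + 1)).2]
      nlinarith
    · refine IsLocalMin.hasDerivAt_eq_zero ?_ hder
      filter_upwards [hnear] with x hx
      rw [(hρZ (k + 1)).2]
      nlinarith

end RadialFlow

/-! ### The sublinear force and its Lipschitz modification. -/

/-- The nonlinearity `x - |x|^(-2θ) x`. -/
noncomputable def sublinearForce (θ x : ℝ) : ℝ := x - |x| ^ (-2 * θ) * x

/-- A globally Lipschitz modification of `sublinearForce θ` on `(-∞, a)`. -/
noncomputable def modifiedForce (θ a x : ℝ) : ℝ :=
  sublinearForce θ (max x a) + 2 * θ * a * min (x - a) 0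

lemma modifiedForce_of_le {θ a x : ℝ} (h : a ≤ x) : modifiedForce θ a x = sublinearForce θ x := by
  simp [modifiedForce, h]

lemma hasDerivAt_sublinearPotential {θ : ℝ} (hθ : θ < 1 / 2) (x : ℝ) :
    HasDerivAt (fun x => x ^ 2 / 2 - |x| ^ (2 - 2 * θ) / (2 - 2 * θ)) (sublinearForce θ x) x := by
  have h1 := (hasDerivAt_abs_rpow x (p := 2 - 2 * θ) (by linarith)).div_const (2 - 2 * θ)
  have h2 := ((hasDerivAt_id x).pow 2).div_const 2
  refine (h2.sub h1).congr_deriv ?_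
  have : 2 - 2 * θ ≠ 0 := by linarith
  rw [sublinearForce, show 2 - 2 * θ - 2 = -2 * θ by ring]
  rw [mul_assoc (2 - 2 * θ), mul_div_cancel_left₀ _ this]
  simp

lemma sublinearForce_eq_rpow {θ x : ℝ} (hx : 0 < x) :
    sublinearForce θ x = x - x ^ (1 - 2 * θ) := by
  rw [sublinearForce, abs_of_pos hx, show 1 - 2 * θ = -2 * θ + 1 by ring, Real.rpow_add_one hx.ne']

/-- From `exp y ≥ 1 + y` and `log x ≤ x - 1` one gets `x^(-2θ) ≥ 1 + 2θ(1 - x)`. -/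
lemma sublinearForce_le {θ x : ℝ} (hθ : 0 < θ) (h0 : 0 < x) :
    sublinearForce θ x ≤ 2 * θ * x * (x - 1) := by
  have h2 : 1 + 2 * θ * (1 - x) ≤ x ^ (-2 * θ) := by
    rw [Real.rpow_def_of_pos h0]
    have h3 := Real.add_one_le_exp (Real.log x * (-2 * θ))
    have h4 := Real.log_le_sub_one_of_pos h0
    nlinarith
  rw [sublinearForce, abs_of_pos h0]
  nlinarith [mul_le_mul_of_nonneg_left h2 h0.le]

/-- Bernoulli's inequality for the exponent `1 - 2θ ∈ (0, 1)`. -/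
lemma le_sublinearForce {θ x : ℝ} (hθ : 0 < θ) (hθ₁ : θ < 1 / 2) (h1 : 1 ≤ x) :
    2 * θ * (x - 1) ≤ sublinearForce θ x := by
  have h2 := rpow_one_add_le_one_add_mul_self (s := x - 1) (p := 1 - 2 * θ) (by linarith)
    (by linarith) (by linarith)
  rw [add_sub_cancel] at h2
  rw [sublinearForce_eq_rpow (by linarith)]
  linarith

section ModifiedForce

variable {θ a : ℝ}

lemma exists_lipschitzWith_modifiedForce (hθ : 0 < θ) (hθ₁ : θ < 1 / 2) (ha : 0 < a) :
    ∃ K : NNReal, LipschitzWith K (modifiedForce θ a) := by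
  have hC : 0 ≤ 1 + a ^ (-2 * θ) := by positivity
  have h1 : ∀ x ∈ Ici a, ∀ y ∈ Ici a,
      ‖sublinearForce θ y - sublinearForce θ x‖ ≤ (1 + a ^ (-2 * θ)) * ‖y - x‖ := by
    intro x hx y hy
    refine (convex_Ici a).norm_image_sub_le_of_norm_hasDerivWithin_le
      (f' := fun x => 1 - (1 - 2 * θ) * x ^ (1 - 2 * θ - 1)) (fun x hx => ?_) (fun x hx => ?_) hx hy
    · have hx0 : 0 < x := ha.trans_le hx
      refine HasDerivAt.hasDerivWithinAt ?_
      refine ((hasDerivAt_id x).sub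
        (Real.hasDerivAt_rpow_const (p := 1 - 2 * θ) (Or.inl hx0.ne'))).congr_of_eventuallyEq ?_
      filter_upwards [lt_mem_nhds hx0] with y hy
      simp [sublinearForce_eq_rpow hy]
    · have hx0 : 0 < x := ha.trans_le hx
      have h2 : x ^ (-2 * θ) ≤ a ^ (-2 * θ) :=
        Real.rpow_le_rpow_of_nonpos ha hx (by linarith)
      have h3 : 0 < x ^ (-2 * θ) := Real.rpow_pos_of_pos hx0 _
      rw [show 1 - 2 * θ - 1 = -2 * θ by ring, Real.norm_eq_abs, abs_le]
      constructor <;> nlinarith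
  refine ⟨⟨1 + a ^ (-2 * θ) + 2 * θ * a, by positivity⟩, LipschitzWith.of_dist_le_mul fun x y => ?_⟩
  have h2 := h1 (max y a) (mem_Ici.2 (le_max_right _ _)) (max x a)
    (mem_Ici.2 (le_max_right _ _))
  have h3 : |max x a - max y a| ≤ |x - y| := by
    simpa using abs_max_sub_max_le_abs x y a
  have h4 : |min (x - a) 0 - min (y - a) 0| ≤ |x - y| := by
    have := abs_min_sub_min_le_max (x - a) 0 (y - a) 0
    simpa using this
  simp only [Real.dist_eq, modifiedForce, Real.norm_eq_abs] at h2 ⊢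
  have e : sublinearForce θ (max x a) + 2 * θ * a * min (x - a) 0 -
      (sublinearForce θ (max y a) + 2 * θ * a * min (y - a) 0) =
      (sublinearForce θ (max x a) - sublinearForce θ (max y a)) +
        2 * θ * a * (min (x - a) 0 - min (y - a) 0) := by ring
  rw [e]
  have h5 : |2 * θ * a * (min (x - a) 0 - min (y - a) 0)| ≤ 2 * θ * a * |x - y| := by
    rw [abs_mul, abs_of_pos (by positivity : 0 < 2 * θ * a)]
    gcongr
  have h6 : (1 + a ^ (-2 * θ)) * |max x a - max y a| ≤ (1 + a ^ (-2 * θ)) * |x - y| := by gcongr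
  have h7 := abs_add_le (sublinearForce θ (max x a) - sublinearForce θ (max y a))
    (2 * θ * a * (min (x - a) 0 - min (y - a) 0))
  change _ ≤ (1 + a ^ (-2 * θ) + 2 * θ * a) * |x - y|
  linarith

lemma modifiedForce_one (ha1 : a ≤ 1) : modifiedForce θ a 1 = 0 := by
  simp [modifiedForce_of_le ha1, sublinearForce]

/-- The slope `2θa` below `a` is chosen for this bound: `sublinearForce_le` gives `g(a) ≤ 2θa(a -
1)`, and the linear piece preserves `g(x) ≤ 2θa(x - 1)`. -/
lemma mul_sq_le_modifiedForce_mul (hθ : 0 < θ) (hθ₁ : θ < 1 / 2) (ha : 0 < a) (ha1 : a < 1)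
    (x : ℝ) : 2 * θ * a * (x - 1) ^ 2 ≤ modifiedForce θ a x * (x - 1) := by
  rcases le_total 1 x with h | h
  · rw [modifiedForce_of_le (ha1.le.trans h)]
    have h1 := mul_le_mul_of_nonneg_right (le_sublinearForce hθ hθ₁ h) (sub_nonneg.2 h)
    have h2 : 2 * θ * a * (x - 1) ^ 2 ≤ 2 * θ * 1 * (x - 1) ^ 2 := by gcongr
    linarith
  · have h1 : modifiedForce θ a x ≤ 2 * θ * a * (x - 1) := by
      rcases le_total a x with hax | hax
      · rw [modifiedForce_of_le hax]
        have h2 := sublinearForce_le hθ (ha.trans_le hax)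
        have h3 : 2 * θ * a * (1 - x) ≤ 2 * θ * x * (1 - x) := by
          have := sub_nonneg.2 h
          gcongr
        linarith
      · rw [modifiedForce, max_eq_right hax, min_eq_left (by linarith)]
        have h2 := sublinearForce_le hθ ha
        linarith
    nlinarith [mul_le_mul_of_nonneg_right h1 (sub_nonneg.2 h)]

end ModifiedForce

/-! ### The energy barrier and the return to the original equation. -/

lemma nonneg_of_hasDerivAt_mul_sub_nonneg {φ φ' : ℝ → ℝ} {c : ℝ} (h : ∀ x, HasDerivAt φ (φ' x) x)
    (hc : φ c = 0) (hφ : ∀ x, 0 ≤ φ' x * (x - c)) (x : ℝ) : 0 ≤ φ x := by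
  have hcont : ∀ s, ContinuousOn φ s := fun s y _ => (h y).continuousAt.continuousWithinAt
  rcases lt_trichotomy x c with hx | rfl | hx
  · obtain ⟨z, hz, e⟩ := exists_hasDerivAt_eq_slope φ φ' hx (hcont _) fun y _ => h y
    have h1 : φ' z ≤ 0 := by nlinarith [hφ z, hz.2]
    have h2 : 0 < c - x := by linarith
    rw [e, hc, zero_sub] at h1
    have := mul_nonpos_of_nonpos_of_nonneg h1 h2.le
    rw [div_mul_cancel₀ _ h2.ne'] at this
    linarith
  · exact hc.ge
  · obtain ⟨z, hz, e⟩ := exists_hasDerivAt_eq_slope φ φ' hx (hcont _) fun y _ => h y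
    have h1 : 0 ≤ φ' z := by nlinarith [hφ z, hz.1]
    have h2 : 0 < x - c := by linarith
    rw [e, hc, sub_zero] at h1
    have := mul_nonneg h1 h2.le
    rwa [div_mul_cancel₀ _ h2.ne'] at this

lemma lt_of_hasDerivAt_neg {G g : ℝ → ℝ} (hG : ∀ x, HasDerivAt G (g x) x) {x y : ℝ} (hxy : x < y)
    (hg : ∀ z ∈ Ioo x y, g z < 0) : G y < G x := by
  obtain ⟨z, hz, e⟩ := exists_hasDerivAt_eq_slope G g hxy
    (fun y _ => (hG y).continuousAt.continuousWithinAt) fun y _ => hG y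
  have h1 := hg z hz
  have h2 : 0 < y - x := by linarith
  rw [e] at h1
  have := mul_neg_of_neg_of_pos h1 h2
  rw [div_mul_cancel₀ _ h2.ne'] at this
  linarith

namespace RadialFlow

variable {d a θ : ℝ} {g G u v : ℝ → ℝ}

/-- The energy barrier on `[b, a)` keeps the solution above its initial value. -/
lemma init_le (hd : 1 < d) (hf : RadialFlow d g a u v) (hG : ∀ x, HasDerivAt G (g x) x) {b : ℝ}
    (hb : b < a) (hbar : ∀ x ∈ Ico b a, G a < G x) {r : ℝ} (hr : 0 ≤ r) : a ≤ u r := by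
  by_contra! h
  -- A solution that drops below `b` passes through `b` by continuity, so a barrier on a bounded
  -- window is enough.
  obtain ⟨s, hs, hsb, hsa⟩ : ∃ s, 0 ≤ s ∧ b ≤ u s ∧ u s < a := by
    rcases le_total b (u r) with hbr | hbr
    · exact ⟨r, hr, hbr, h⟩
    · have hc : b ∈ Icc (u r) (u 0) := ⟨hbr, by rw [hf.init]; exact hb.le⟩
      obtain ⟨s, hs, e⟩ := intermediate_value_Icc' hr
        (hf.continuousOn.mono fun x hx => hx.1) hc
      exact ⟨s, hs.1, e.ge, e ▸ hb⟩
  have h1 := hf.energy_le hd hG hs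
  have h2 := hbar _ ⟨hsb, hsa⟩
  nlinarith [sq_nonneg (v s)]

lemma congr {g' : ℝ → ℝ} (hf : RadialFlow d g a u v) (h : ∀ r, 0 < r → g (u r) = g' (u r)) :
    RadialFlow d g' a u v :=
  { hf with hasDerivAt_vel := fun r hr => h r hr ▸ hf.hasDerivAt_vel r hr }

lemma isRadialSolution (hf : RadialFlow d (sublinearForce θ) a u v) (hu : ContDiff ℝ 2 u)
    (huv : ∀ r, HasDerivAt u (v r) r) : IsRadialSolution d θ a u where
  contDiffOn := hu.contDiffOn
  equation r hr := by
    have e : deriv u = v := funext fun r => (huv r).deriv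
    rw [e, (hf.hasDerivAt_vel r hr).deriv, sublinearForce]
    ring
  init_value := hf.init
  init_deriv := by
    have := (huv 0).hasDerivWithinAt (s := Ici 0)
    rwa [hf.init_vel] at this

end RadialFlow

namespace IsRadialSolution

variable {d a θ : ℝ} {u : ℝ → ℝ}

/-- The velocity is the one-sided derivative because values of `u` at negative arguments are
arbitrary, so `deriv u 0` carries no information. -/
lemma radialFlow (h : IsRadialSolution d θ a u) :
    RadialFlow d (sublinearForce θ) a u (derivWithin u (Ici 0)) := by
  have hu := h.contDiffOn
  have hv : ContDiffOn ℝ 1 (derivWithin u (Ici 0)) (Ici 0) :=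
    hu.derivWithin (uniqueDiffOn_Ici 0) (by norm_num)
  refine ⟨hu.continuousOn, hv.continuousOn, fun r hr => ?_, fun r hr => ?_, h.init_value,
    h.init_deriv.derivWithin (uniqueDiffOn_Ici 0 0 self_mem_Ici)⟩
  · exact (hu.differentiableOn (by norm_num) r hr.le).hasDerivWithinAt.hasDerivAt
      (Ici_mem_nhds hr)
  · have h1 : derivWithin u (Ici 0) =ᶠ[𝓝 r] deriv u := by
      filter_upwards [lt_mem_nhds hr] with x hx using derivWithin_of_mem_nhds (Ici_mem_nhds hx)
    have h2 := (hv.differentiableOn (by norm_num) r hr.le).differentiableAt (Ici_mem_nhds hr)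
    have h3 := h2.hasDerivAt
    rw [h1.deriv_eq] at h3
    refine h3.congr_deriv ?_
    rw [h1.self_of_nhds, sublinearForce]
    linarith [h.equation r hr]

lemma neg (h : IsRadialSolution d θ a u) : IsRadialSolution d θ (-a) (-u) where
  contDiffOn := h.contDiffOn.neg
  equation r hr := by
    have h1 : deriv (-u) = -deriv u := by ext x; simp
    have h2 : deriv (-deriv u) r = -deriv (deriv u) r := by simp
    rw [h1, h2]
    simp only [Pi.neg_apply, abs_neg]
    linarith [h.equation r hr]
  init_value := by simp [h.init_value]
  init_deriv := by simpa using h.init_deriv.neg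

end IsRadialSolution

lemma exists_radialSolution_of_pos {d θ a : ℝ} (hd : 1 < d) (hθ : 0 < θ) (hθ₁ : θ < 1 / 2)
    (ha : 0 < a) (ha1 : a < 1) :
    ∃ u : ℝ → ℝ, IsRadialSolution d θ a u ∧
      (∀ v : ℝ → ℝ, IsRadialSolution d θ a v → EqOn v u (Ici 0)) ∧
      (∀ r : ℝ, 0 < r → 0 < u r) ∧ (∃ ρ τ : ℕ → ℝ, IsCrossingExtremaSequence u 1 ρ τ) ∧
      Tendsto u atTop (𝓝 1) := by
  obtain ⟨K, hK⟩ := exists_lipschitzWith_modifiedForce hθ hθ₁ ha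
  obtain ⟨u, v, hu, huv, hf⟩ := exists_radialFlow hd hK a
  set g := modifiedForce θ a
  set κ := 2 * θ * a with hκ
  have hκ0 : 0 < κ := by positivity
  have hK0 : (0 : ℝ) ≤ K := K.2
  have hg : ∀ x, κ * (x - 1) ^ 2 ≤ g x * (x - 1) := mul_sq_le_modifiedForce_mul hθ hθ₁ ha ha1
  have hg1 : g 1 = 0 := modifiedForce_one ha1.le
  have hgup : ∀ x, g x * (x - 1) ≤ K * (x - 1) ^ 2 := by
    intro x
    have h1 : |g x| ≤ K * |x - 1| := by simpa [Real.dist_eq, hg1] using hK.dist_le_mul x 1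
    calc g x * (x - 1) ≤ |g x| * |x - 1| := by rw [← abs_mul]; exact le_abs_self _
      _ ≤ K * |x - 1| * |x - 1| := by gcongr
      _ = K * (x - 1) ^ 2 := by rw [mul_assoc, ← sq, sq_abs]
  set G : ℝ → ℝ := fun x => ∫ t in (1 : ℝ)..x, g t
  have hG : ∀ x, HasDerivAt G (g x) x := fun x =>
    intervalIntegral.integral_hasDerivAt_right (hK.continuous.intervalIntegrable _ _)
      hK.continuous.aestronglyMeasurable.stronglyMeasurableAtFilter hK.continuous.continuousAt
  have hG1 : G 1 = 0 := intervalIntegral.integral_same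
  have hquad : ∀ C x : ℝ, HasDerivAt (fun x => C / 2 * (x - 1) ^ 2) (C * (x - 1)) x := by
    intro C x
    refine ((((hasDerivAt_id x).sub_const 1).pow 2).const_mul (C / 2)).congr_deriv ?_
    simp only [id]
    ring
  have hGlow : ∀ x, κ / 2 * (x - 1) ^ 2 ≤ G x := fun x => sub_nonneg.1 <|
    nonneg_of_hasDerivAt_mul_sub_nonneg (φ := fun x => G x - κ / 2 * (x - 1) ^ 2) (c := 1)
      (fun x => (hG x).sub (hquad κ x)) (by simp [hG1]) (fun x => by linarith [hg x]) x
  have hGup : ∀ x, G x ≤ (K + 1) / 2 * (x - 1) ^ 2 := fun x => sub_nonneg.1 <|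
    nonneg_of_hasDerivAt_mul_sub_nonneg (φ := fun x => (K + 1) / 2 * (x - 1) ^ 2 - G x) (c := 1)
      (fun x => (hquad (K + 1) x).sub (hG x)) (by simp [hG1])
      (fun x => by nlinarith [hgup x, sq_nonneg (x - 1)]) x
  have hgG : ∀ x, 2 * κ / (K + 1) * G x ≤ g x * (x - 1) := fun x => by
    refine le_trans ?_ (hg x)
    calc 2 * κ / (K + 1) * G x ≤ 2 * κ / (K + 1) * ((K + 1) / 2 * (x - 1) ^ 2) := by
          gcongr; exact hGup x
      _ = κ * (x - 1) ^ 2 := by field_simp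
  -- The modified force is negative on all of `(-∞, 1)`, so any window below `a` works; `a - 1` is
  -- an arbitrary choice.
  have hle : ∀ r, 0 ≤ r → a ≤ u r := fun r hr =>
    hf.init_le hd hG (sub_one_lt a) (fun x hx => lt_of_hasDerivAt_neg hG hx.2 fun z hz => by
      have h1 := hg z
      have h2 : z < 1 := hz.2.trans ha1
      have h3 : 0 < κ * (z - 1) ^ 2 := mul_pos hκ0 (sq_pos_of_neg (by linarith))
      nlinarith) hr
  refine ⟨u, (hf.congr fun r hr => modifiedForce_of_le (hle r hr.le)).isRadialSolution hu huv,
    fun w hw => ?_, fun r hr => ha.trans_le (hle r hr.le),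
    hf.exists_isCrossingExtremaSequence hd hκ0 hg hG (half_pos hκ0) hGlow hG1 ha1.ne,
    hf.tendsto_center hd (half_pos hκ0) (by positivity) hG hGlow hgG⟩
  have hwf := hw.radialFlow
  -- For the original force the window is `[0, a)`: the force is negative on `(0, 1)` but positive
  -- on `(-1, 0)`. Staying above `a`, `w` also solves the modified equation, where uniqueness is
  -- available.
  have hwle : ∀ r, 0 ≤ r → a ≤ w r := fun r hr =>
    hwf.init_le hd (hasDerivAt_sublinearPotential hθ₁) ha
      (fun x hx => lt_of_hasDerivAt_neg (hasDerivAt_sublinearPotential hθ₁) hx.2 fun z hz => by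
        have h0 : 0 < z := hx.1.trans_lt hz.1
        have h1 : z < 1 := hz.2.trans ha1
        have h2 := sublinearForce_le hθ h0
        have h3 : 0 < 2 * θ * z * (1 - z) := by
          have := sub_pos.2 h1
          positivity
        linarith) hr
  exact (hwf.congr fun r hr => (modifiedForce_of_le (hwle r hr.le)).symm).eqOn hd hK hf

theorem theorem1 (d θ a : ℝ) (hd : 1 < d) (hθ₀ : 0 < θ) (hθ₁ : θ < 1 / 2)
    (ha : a ∈ Ioo (-1 : ℝ) 1 \ {0}) :
    ∃ u : ℝ → ℝ, IsRadialSolution d θ a u ∧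
      (∀ v : ℝ → ℝ, IsRadialSolution d θ a v → EqOn v u (Ici 0)) ∧
      (∀ r : ℝ, 0 < r → u r ≠ 0) ∧
      (0 < a → OscillatesAround u 1 ∧
        (∃ ρ τ : ℕ → ℝ, IsCrossingExtremaSequence u 1 ρ τ ∧
          Tendsto (fun k => u (τ k)) atTop (𝓝 1)) ∧
        Tendsto u atTop (𝓝 1)) ∧
      (a < 0 → OscillatesAround u (-1) ∧
        (∃ ρ τ : ℕ → ℝ, IsCrossingExtremaSequence u (-1) ρ τ ∧
          Tendsto (fun k => u (τ k)) atTop (𝓝 (-1))) ∧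
        Tendsto u atTop (𝓝 (-1))) := by
  obtain ⟨⟨ha₁, ha₂⟩, ha₀⟩ := ha
  rcases lt_or_gt_of_ne (show a ≠ 0 from ha₀) with hneg | hpos
  · obtain ⟨u, hu, huniq, hu0, ⟨ρ, τ, hseq⟩, hlim⟩ :=
      exists_radialSolution_of_pos hd hθ₀ hθ₁ (neg_pos.2 hneg) (by linarith : -a < 1)
    have hlim' : Tendsto (-u) atTop (𝓝 (-1)) := hlim.neg
    refine ⟨-u, by simpa using hu.neg, fun v hv r hr => ?_, fun r hr => ?_,
      fun h => absurd h hneg.not_gt, fun _ => ⟨hseq.neg.oscillatesAround,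
        ⟨ρ, τ, hseq.neg, hlim'.comp hseq.tendsto_extrema⟩, hlim'⟩⟩
    · have := huniq _ hv.neg hr
      simp only [Pi.neg_apply] at this ⊢
      linarith
    · exact neg_ne_zero.2 (hu0 r hr).ne'
  · obtain ⟨u, hu, huniq, hu0, ⟨ρ, τ, hseq⟩, hlim⟩ :=
      exists_radialSolution_of_pos hd hθ₀ hθ₁ hpos ha₂
    exact ⟨u, hu, huniq, fun r hr => (hu0 r hr).ne', fun _ => ⟨hseq.oscillatesAround,
      ⟨ρ, τ, hseq, hlim.comp hseq.tendsto_extrema⟩, hlim⟩, fun h => absurd h hpos.not_gt⟩
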